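/- **Theorem (lower bound for independent arms).** Let $1 \le p \le k < n$ and $\delta \in (0,1)$. Let $\nu = \prod_{i=1}^n \nu_i$ be a product distribution on $\{0,1\}^n$, where $\nu_i$ is the Bernoulli distribution with mean $\mu_i \in [0,1)$, and assume $\mu_1 \ge \dots \ge \mu_k > \mu_{k+1} \ge \dots \ge \mu_n$. At each time $t$ nature draws $X^{(t)} \sim \nu$ independently, and an adaptive, possibly randomized, algorithm queries a set $S_t \subset [n]$ of exactly $p$ arms and observes $\max_{i \in S_t} X^{(t)}_i$ (bandit feedback) or the sub-vector $(X^{(t)}_i)_{i \in S_t}$ (semi-bandit feedback); at a time of its choice it stops and returns a set of arms. The ordering of the arms is unknown to the algorithm: suppose that for every product of Bernoulli distributions with means in $[0,1)$, in any order, whose $k$-th and $(k+1)$-st largest means differ, it stops and returns the set of the $k$ arms with the largest means with probability at least $1-\delta$. Then under $\nu$ the expected number of observations (queries) that it makes before it stops is at least $$\Big( \max_{1 \le j \le n} \tau_j + \frac1p \sum_{j=1}^n \tau_j \Big) \log\Big(\frac{1}{2\delta}\Big).$$ Here $\Delta_j = \mu_j - \mu_{k+1}$ for $j \le k$ and $\Delta_j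 = \mu_k - \mu_j$ for $j > k$, and (i) for bandit feedback, with $h_j = \max \big\{ \prod_{i \in S} (1-\mu_i) : S \subset [n] \setminus \{j\},\ |S| = p-1 \big\}$, $$\tau_j = \begin{cases} \dfrac{1-\mu_j-\Delta_j}{\Delta_j^2} \cdot \dfrac{1-h_j+\mu_j h_j}{h_j} & j > k, \\[2mm] \dfrac{1-\mu_j}{\Delta_j^2} \cdot \dfrac{1-h_j+(\mu_j-\Delta_j) h_j}{h_j} & j \le k; \end{cases}$$ (ii) for semi-bandit feedback, $$\tau_j = \begin{cases} \dfrac{(1-\mu_j-\Delta_j)\,\mu_j}{\Delta_j^2} & j > k, \\[2mm] \dfrac{(1-\mu_j)(\mu_j-\Delta_j)}{\Delta_j^2} & j \le k. \end{cases}$$ -/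

import Mathlib

open MeasureTheory ProbabilityTheory
open scoped ENNReal unitInterval

noncomputable section

namespace BestOfK

/-- One draw of the rewards of `n` arms: `x i = true` means that arm `i` has reward `1`. -/
abbrev Reward (n : ℕ) : Type := Fin n → Bool

/-- The product distribution `ν = ∏ νᵢ`, where `νᵢ` is the Bernoulli distribution on `{0, 1}` with
mean `μ i`. -/
def armLaw {n : ℕ} (μ : Fin n → I) : Measure (Reward n) :=
  Measure.pi fun i => bernoulliMeasure true false (μ i)

/-- Bandit feedback: querying `S` reveals `max_{i ∈ S} xᵢ` (in `Bool`, `false < true`). -/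
def banditFeedback {n : ℕ} (S : Finset (Fin n)) (x : Reward n) : Bool :=
  S.sup x

/-- Semi-bandit feedback: querying `S` reveals the sub-vector `(xᵢ)_{i ∈ S}`, and nothing about the
other arms. -/
def semiBanditFeedback {n : ℕ} (S : Finset (Fin n)) (x : Reward n) : Fin n → Option Bool :=
  fun i => if i ∈ S then some (x i) else none

/-- An adaptive randomized algorithm on `n` arms that queries sets of exactly `p` arms and receives
observations in `O`. Its internal randomness is a seed in `U`, drawn before the first query. Given
the seed and the list of the observations so far (these determine the past queries), `decision` says
whether to go on (`none`) or to stop and return a set (`some S`), and `query` is the next set to be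
queried if the algorithm goes on. -/
structure Algorithm (n p : ℕ) (O U : Type*) [MeasurableSpace U] where
  query : U → List O → Finset (Fin n)
  decision : U → List O → Option (Finset (Fin n))
  card_query : ∀ u h, (query u h).card = p
  measurableSet_query : ∀ h S, MeasurableSet {u | query u h = S}
  measurableSet_decision : ∀ h d, MeasurableSet {u | decision u h = d}

namespace Algorithm

variable {n p : ℕ} {O U : Type*} [MeasurableSpace U]

/-- The observations made by the first `t` queries when `x s` is the reward vector that nature draws
at time `s`, and the algorithm is not stopped before time `t`. -/
def history (A : Algorithm n p O U) (feedback : Finset (Fin n) → Reward n → O)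
    (u : U) (x : ℕ → Reward n) : ℕ → List O
  | 0 => []
  | t + 1 => A.history feedback u x t ++ [feedback (A.query u (A.history feedback u x t)) (x t)]

/-- The number of queries (observations) made before termination; `⊤` if the algorithm never
stops. -/
def numQueries (A : Algorithm n p O U) (feedback : Finset (Fin n) → Reward n → O)
    (u : U) (x : ℕ → Reward n) : ℕ∞ :=
  ⨅ (t : ℕ) (_ : (A.decision u (A.history feedback u x t)).isSome), (t : ℕ∞)

/-- The algorithm stops, and returns `S`. -/
def Returns (A : Algorithm n p O U) (feedback : Finset (Fin n) → Reward n → O)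
    (u : U) (x : ℕ → Reward n) (S : Finset (Fin n)) : Prop :=
  ∃ t, A.decision u (A.history feedback u x t) = some S ∧
    ∀ s < t, A.decision u (A.history feedback u x s) = none

end Algorithm

/-- The joint law of the seed and of the i.i.d. reward vectors when the arms have means `μ`. -/
def law {n : ℕ} {U : Type*} [MeasurableSpace U] (ρ : Measure U) (μ : Fin n → I) :
    Measure (U × (ℕ → Reward n)) :=
  ρ.prod (Measure.infinitePi fun _ : ℕ => armLaw μ)

/-- `S` consists of `k` arms, each with a larger mean than every arm outside `S`. (Such a set is
unique, and it exists if and only if the `k`-th and the `(k+1)`-st largest means differ.) -/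
def IsTopSet {n : ℕ} (k : ℕ) (μ : Fin n → I) (S : Finset (Fin n)) : Prop :=
  S.card = k ∧ ∀ i ∈ S, ∀ j ∉ S, μ j < μ i

namespace Algorithm

variable {n p : ℕ} {O U : Type*} [MeasurableSpace U]

/-- The algorithm identifies the top `k` arms with probability at least `1 - δ`: for all means in
`[0, 1)`, in any order, for which the set of the top `k` arms is well defined, it stops and returns
this set with probability at least `1 - δ`. -/
def IdentifiesTop (A : Algorithm n p O U) (feedback : Finset (Fin n) → Reward n → O)
    (ρ : Measure U) (k : ℕ) (δ : ℝ) : Prop :=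
  ∀ μ : Fin n → I, (∀ i, μ i < 1) → ∀ S : Finset (Fin n), IsTopSet k μ S →
    ENNReal.ofReal (1 - δ) ≤ law ρ μ {ω | A.Returns feedback ω.1 ω.2 S}

/-- The expected number of observations when the arms have means `μ`. -/
def expectedQueries (A : Algorithm n p O U) (feedback : Finset (Fin n) → Reward n → O)
    (ρ : Measure U) (μ : Fin n → I) : ℝ≥0∞ :=
  ∫⁻ ω, (A.numQueries feedback ω.1 ω.2 : ℝ≥0∞) ∂(law ρ μ)

end Algorithm

/-- The gap `Δⱼ`. Arms are numbered from `0`, so the arms `1, …, k` are those of index `< k`, and the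
means `μ_k`, `μ_{k+1}` belong to the indices `k - 1`, `k`. -/
def gap {n k : ℕ} (hk : 1 ≤ k) (hkn : k < n) (μ : Fin n → I) (j : Fin n) : ℝ :=
  if (j : ℕ) < k then (μ j : ℝ) - μ ⟨k, hkn⟩ else (μ ⟨k - 1, by omega⟩ : ℝ) - μ j

/-- The information-sharing term `hⱼ = max ∏_{i ∈ S} (1 - μᵢ)` over the sets `S` of `p - 1` arms
other than `j` (a maximum over a finite set, nonempty if `1 ≤ p ≤ n`). -/
def infoSharing {n : ℕ} (p : ℕ) (μ : Fin n → I) (j : Fin n) : ℝ :=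
  ⨆ S : {S : Finset (Fin n) // j ∉ S ∧ S.card = p - 1}, ∏ i ∈ S.1, (1 - (μ i : ℝ))

/-- `τⱼ` for bandit feedback. -/
def tauBandit {n k : ℕ} (p : ℕ) (hk : 1 ≤ k) (hkn : k < n) (μ : Fin n → I) (j : Fin n) : ℝ :=
  let Δ := gap hk hkn μ j
  let h := infoSharing p μ j
  if (j : ℕ) < k then
    (1 - (μ j : ℝ)) / Δ ^ 2 * ((1 - h + ((μ j : ℝ) - Δ) * h) / h)
  else
    (1 - (μ j : ℝ) - Δ) / Δ ^ 2 * ((1 - h + (μ j : ℝ) * h) / h)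

/-- `τⱼ` for semi-bandit feedback. -/
def tauSemiBandit {n k : ℕ} (hk : 1 ≤ k) (hkn : k < n) (μ : Fin n → I) (j : Fin n) : ℝ :=
  let Δ := gap hk hkn μ j
  if (j : ℕ) < k then
    (1 - (μ j : ℝ)) * ((μ j : ℝ) - Δ) / Δ ^ 2
  else
    (1 - (μ j : ℝ) - Δ) * (μ j : ℝ) / Δ ^ 2

/-- `(maxⱼ τⱼ + (1/p) ∑ⱼ τⱼ) log (1/(2δ))`. -/
def lowerBound {n : ℕ} (p : ℕ) (δ : ℝ) (τ : Fin n → ℝ) : ℝ :=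
  ((⨆ j, τ j) + 1 / (p : ℝ) * ∑ j, τ j) * Real.log (1 / (2 * δ))

end BestOfK

end

noncomputable section

namespace BestOfK

/-! The proof is a change of measure to an instance with a tie. Moving the mean of the single arm
`j` across the gap, to `tieMean`, leaves two different sets that both qualify as top sets.
Perturbing the tie in favour of either one shows that, under the tied instance, every run truncated
at a fixed number of queries ends with probability at most `2 * δ`
(`IdentifiesTop.meanValue_termination_le`). Under `μ`, if the expected number of queries is finite,
the run stops almost surely.

Telling the two instances apart therefore requires information `log (1 / (2δ))`. Only queries
containing `j` give information, each at most `1 / (2 * τ j)`, so `j` is queried at least `2 * τ j *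
log (1 / (2δ))` times on average. The total number of queries dominates this for each `j`, and `p`
times the total is the sum over `j`; averaging the two resulting bounds gives the theorem
(`IdentifiesTop.lowerBound_le`).

Divergence appears only in Donsker-Varadhan form, `exp (E F - κ) ≤ E' (exp F)` for all `F`. This
form passes through a run by induction on its length (`exp_seedValue_le`), with no likelihood ratios
of histories. -/

/-! ### Quadratic bounds for the Bernoulli divergence. -/

lemma two_point_kl_le {a b : ℝ} (ha : 0 < a) (hab : a ≤ b) (hb : b < 1) :
    a * (Real.log a - Real.log b) + (1 - a) * (Real.log (1 - a) - Real.log (1 - b)) ≤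
      (b - a) ^ 2 / (2 * (a * (1 - b))) := by
  have h1b : 0 < 1 - b := by linarith
  let g : ℝ → ℝ := fun x =>
    (x - a) ^ 2 / (2 * (a * (1 - b))) + a * Real.log x + (1 - a) * Real.log (1 - x)
  have hd : ∀ x ∈ Set.Icc a b,
      HasDerivAt g ((x - a) / (a * (1 - b)) - (x - a) / (x * (1 - x))) x := by
    intro x hx
    have hx0 : 0 < x := lt_of_lt_of_le ha hx.1
    have hx1 : 0 < 1 - x := by linarith [hx.2]
    have h1 : HasDerivAt (fun x : ℝ => (x - a) ^ 2 / (2 * (a * (1 - b))))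
        (2 * (x - a) / (2 * (a * (1 - b)))) x := by
      have := (((hasDerivAt_id x).sub_const a).pow 2).div_const (2 * (a * (1 - b)))
      simpa using this
    have h2 := (Real.hasDerivAt_log hx0.ne').const_mul a
    have h3 := (((hasDerivAt_id x).const_sub 1).log hx1.ne').const_mul (1 - a)
    refine HasDerivAt.congr_deriv (f := g) ((h1.add h2).add h3) ?_
    simp only [id]
    field_simp
    ring
  -- As a function of its second mean `x`, the divergence has derivative `(x - a) / (x * (1 - x))`,
  -- and `x * (1 - x) ≥ a * (1 - b)` on `[a, b]`. Integrating `x - a` gives the factor `1 / 2`, the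
  -- source of the 2 in `2 * τ`.
  have hmono : MonotoneOn g (Set.Icc a b) := by
    refine monotoneOn_of_deriv_nonneg (convex_Icc a b)
      (fun x hx => (hd x hx).continuousAt.continuousWithinAt)
      (fun x hx => (hd x (interior_subset hx)).differentiableAt.differentiableWithinAt) ?_
    intro x hx
    have hx := interior_subset hx
    rw [(hd x hx).deriv, sub_nonneg]
    have hx1 : 0 ≤ 1 - x := by linarith [hx.2]
    exact div_le_div_of_nonneg_left (by linarith [hx.1]) (by positivity)
      (mul_le_mul hx.1 (by linarith [hx.2]) h1b.le (ha.le.trans hx.1))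
  have := hmono (Set.left_mem_Icc.2 hab) (Set.right_mem_Icc.2 hab) hab
  simp only [g, sub_self] at this
  norm_num at this
  linarith

/-- The Donsker-Varadhan inequality for two Bernoulli distributions with means `a ≤ b`. -/
lemma exp_mean_sub_le_of_le {a b : ℝ} (ha : 0 < a) (hab : a ≤ b) (hb : b < 1) (s t : ℝ) :
    Real.exp ((1 - a) * s + a * t - (b - a) ^ 2 / (2 * (a * (1 - b)))) ≤
      (1 - b) * Real.exp s + b * Real.exp t := by
  have h1b : 0 < 1 - b := by linarith
  have h1a : 0 < 1 - a := by linarith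
  have hb0 : 0 < b := by linarith
  have hJ : Real.exp ((1 - a) * (s + (Real.log (1 - b) - Real.log (1 - a))) +
      a * (t + (Real.log b - Real.log a))) ≤
      (1 - a) * Real.exp (s + (Real.log (1 - b) - Real.log (1 - a))) +
        a * Real.exp (t + (Real.log b - Real.log a)) :=
    convexOn_exp.2 (Set.mem_univ _) (Set.mem_univ _) h1a.le ha.le (by ring)
  refine (Real.exp_le_exp.2 ?_).trans (hJ.trans_eq ?_)
  · linarith [two_point_kl_le ha hab hb]
  · simp only [Real.exp_add, Real.exp_sub, Real.exp_log h1b, Real.exp_log h1a,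
      Real.exp_log hb0, Real.exp_log ha]
    field_simp

/-- Exchanging the two outcomes reverses the order of the means. -/
lemma exp_mean_sub_le_of_ge {a b : ℝ} (hb : 0 < b) (hab : b ≤ a) (ha : a < 1) (s t : ℝ) :
    Real.exp ((1 - a) * s + a * t - (a - b) ^ 2 / (2 * (b * (1 - a)))) ≤
      (1 - b) * Real.exp s + b * Real.exp t := by
  have := exp_mean_sub_le_of_le (a := 1 - a) (b := 1 - b) (by linarith) (by linarith)
    (by linarith) t s
  convert this using 1
  · congr 1
    ring
  · ring

/-! ### One draw from the product law. -/

variable {n : ℕ}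

instance (μ : Fin n → I) : IsProbabilityMeasure (armLaw μ) := by
  unfold armLaw; infer_instance

lemma bernoulliMeasure_real_singleton (q : I) (b : Bool) :
    (bernoulliMeasure true false q).real {b} = if b then (q : ℝ) else 1 - q := by
  cases b <;> simp

lemma armLaw_real_singleton (μ : Fin n → I) (x : Reward n) :
    (armLaw μ).real {x} = ∏ i, if x i then (μ i : ℝ) else 1 - μ i := by
  rw [armLaw, measureReal_def, Measure.pi_singleton, ENNReal.toReal_prod]
  exact Finset.prod_congr rfl fun i _ => bernoulliMeasure_real_singleton _ _

lemma integrable_armLaw (μ : Fin n → I) (f : Reward n → ℝ) : Integrable f (armLaw μ) :=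
  Integrable.of_finite

lemma integral_armLaw (μ : Fin n → I) (f : Reward n → ℝ) :
    ∫ x, f x ∂(armLaw μ) = ∑ x, (∏ i, if x i then (μ i : ℝ) else 1 - μ i) * f x := by
  rw [integral_fintype (integrable_armLaw μ f)]
  simp [armLaw_real_singleton]

lemma exp_integral_armLaw_le (μ : Fin n → I) (f : Reward n → ℝ) :
    Real.exp (∫ x, f x ∂(armLaw μ)) ≤ ∫ x, Real.exp (f x) ∂(armLaw μ) :=
  convexOn_exp.map_integral_le Real.continuous_exp.continuousOn isClosed_univ
    (by simp) (integrable_armLaw _ _) (integrable_armLaw _ _)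

/-- Resampling the reward of arm `j` changes its mean. -/
lemma integral_armLaw_update (μ : Fin n → I) (j : Fin n) (q : I) (f : Reward n → ℝ) :
    ∫ x, f x ∂(armLaw (Function.update μ j q)) =
      ∫ x, ((1 - (q : ℝ)) * f (Function.update x j false) +
        (q : ℝ) * f (Function.update x j true)) ∂(armLaw μ) := by
  have hmeas : Measurable fun z : Reward n × Bool => Function.update z.1 j z.2 :=
    measurable_of_finite _
  have hmap : armLaw (Function.update μ j q) =
      ((armLaw μ).prod (bernoulliMeasure true false q)).map
        fun z => Function.update z.1 j z.2 := by
    refine Measure.pi_eq fun s hs => ?_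
    rw [Measure.map_apply hmeas (.univ_pi hs)]
    have : (fun z : Reward n × Bool => Function.update z.1 j z.2) ⁻¹' Set.univ.pi s =
        (Set.univ.pi (Function.update s j Set.univ)) ×ˢ s j := by
      ext ⟨x, b⟩
      simp only [Set.mem_preimage, Set.mem_univ_pi, Set.mem_prod]
      constructor
      · intro h
        refine ⟨fun i => ?_, by simpa using h j⟩
        by_cases hi : i = j
        · subst hi; simp
        · simpa [hi] using h i
      · rintro ⟨h, hb⟩ i
        by_cases hi : i = j
        · subst hi; simpa using hb
        · simpa [hi] using h i
    rw [this, Measure.prod_prod, armLaw, Measure.pi_pi,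
      ← Finset.mul_prod_erase _ _ (Finset.mem_univ j),
      ← Finset.mul_prod_erase _ (fun i => bernoulliMeasure true false (Function.update μ j q i) (s i))
        (Finset.mem_univ j), mul_comm]
    congr 1
    · simp
    · simp only [Function.update_self, measure_univ, one_mul]
      refine Finset.prod_congr rfl fun i hi => ?_
      simp [(Finset.mem_erase.1 hi).1]
  rw [hmap, integral_map hmeas.aemeasurable (measurable_of_finite _).aestronglyMeasurable,
    integral_prod _ Integrable.of_finite]
  refine integral_congr_ae (ae_of_all _ fun x => ?_)
  simp only
  rw [integral_fintype Integrable.of_finite]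
  simp [bernoulliMeasure_real_singleton, add_comm]

/-- Raising the means of some arms shrinks the weight of an outcome by a bounded factor only. -/
lemma integral_armLaw_le_of_le {μ μ' : Fin n → I} {c : ℝ} (hc : 1 ≤ c) (hle : ∀ i, μ i ≤ μ' i)
    (hc' : ∀ i, 1 - (μ i : ℝ) ≤ c * (1 - μ' i)) {f : Reward n → ℝ} (hf : ∀ x, 0 ≤ f x) :
    ∫ x, f x ∂(armLaw μ) ≤ c ^ n * ∫ x, f x ∂(armLaw μ') := by
  rw [integral_armLaw, integral_armLaw, Finset.mul_sum]
  refine Finset.sum_le_sum fun x _ => ?_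
  rw [← mul_assoc]
  refine mul_le_mul_of_nonneg_right ?_ (hf x)
  calc (∏ i, if x i then (μ i : ℝ) else 1 - μ i)
      ≤ ∏ i, c * (if x i then (μ' i : ℝ) else 1 - μ' i) := by
        refine Finset.prod_le_prod (fun i _ => ?_) fun i _ => ?_
        · split_ifs
          · exact (μ i).2.1
          · exact sub_nonneg.2 (μ i).2.2
        · split_ifs
          · have h1 : (μ i : ℝ) ≤ μ' i := hle i
            nlinarith [(μ' i).2.1]
          · exact hc' i
    _ = _ := by rw [Finset.prod_mul_distrib]; simp

/-! ### Splitting off the first term of an i.i.d. sequence. -/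

section Stream

variable {X : Type*} [MeasurableSpace X]

lemma measurable_cons :
    Measurable fun z : X × (ℕ → X) =>
      (fun i => Nat.casesOn (motive := fun _ => X) i z.1 z.2 : ℕ → X) := by
  refine measurable_pi_lambda _ fun i => ?_
  cases i with
  | zero => exact measurable_fst
  | succ i => exact (measurable_pi_apply i).comp measurable_snd

lemma measurable_shift : Measurable fun (x : ℕ → X) (s : ℕ) => x (s + 1) :=
  measurable_pi_lambda _ fun s => measurable_pi_apply (s + 1)

lemma map_cons_infinitePi (ν : Measure X) [IsProbabilityMeasure ν] :
    (ν.prod (Measure.infinitePi fun _ : ℕ => ν)).map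
      (fun z => (fun i => Nat.casesOn (motive := fun _ => X) i z.1 z.2 : ℕ → X)) =
      Measure.infinitePi fun _ : ℕ => ν := by
  refine Measure.eq_infinitePi _ fun s t ht => ?_
  rw [Measure.map_apply measurable_cons
    (.pi (Finset.countable_toSet s) fun i _ => ht i)]
  have hinj : Set.InjOn Nat.succ (Nat.succ ⁻¹' (s : Set ℕ)) := Nat.succ_injective.injOn
  have : (fun z : X × (ℕ → X) =>
      (fun i => Nat.casesOn (motive := fun _ => X) i z.1 z.2 : ℕ → X)) ⁻¹' (s : Set ℕ).pi t =
      (if 0 ∈ s then t 0 else Set.univ) ×ˢ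
        ((s.preimage Nat.succ hinj : Finset ℕ) : Set ℕ).pi fun i => t (i + 1) := by
    ext ⟨y, x⟩
    simp only [Set.mem_preimage, Set.mem_pi, Set.mem_prod, Finset.mem_coe, Finset.mem_preimage]
    constructor
    · intro h
      refine ⟨?_, fun i hi => h (i + 1) hi⟩
      split_ifs with h0
      · exact h 0 h0
      · trivial
    · rintro ⟨h0, h⟩ i hi
      cases i with
      | zero => simpa [hi] using h0
      | succ i => exact h i hi
  rw [this, Measure.prod_prod, Measure.infinitePi_pi _ fun i _ => ht _]
  have hsucc : ∏ i ∈ s.preimage Nat.succ hinj, ν (t (i + 1)) = ∏ i ∈ s.erase 0, ν (t i) := by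
    refine (Finset.prod_map _ ⟨Nat.succ, Nat.succ_injective⟩ fun i => ν (t i)).symm.trans ?_
    congr 1
    ext i
    cases i <;> simp
  rw [hsucc]
  split_ifs with h0
  · exact Finset.mul_prod_erase s (fun i => ν (t i)) h0
  · rw [measure_univ, one_mul, Finset.erase_eq_of_notMem h0]

lemma integral_infinitePi_cons (ν : Measure X) [IsProbabilityMeasure ν] {f : (ℕ → X) → ℝ}
    (hf : Integrable f (Measure.infinitePi fun _ : ℕ => ν)) :
    ∫ x, f x ∂(Measure.infinitePi fun _ : ℕ => ν) =
      ∫ y, ∫ x, f (fun i => Nat.casesOn (motive := fun _ => X) i y x)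
        ∂(Measure.infinitePi fun _ : ℕ => ν) ∂ν := by
  have hf' := hf
  rw [← map_cons_infinitePi ν] at hf'
  conv_lhs => rw [← map_cons_infinitePi ν]
  rw [integral_map measurable_cons.aemeasurable hf'.aestronglyMeasurable]
  exact integral_prod _ (hf'.comp_measurable measurable_cons)

end Stream

/-! ### Additive functionals of truncated runs. -/

namespace Algorithm

variable {n p : ℕ} {O U : Type*} [MeasurableSpace U]

/-- The reward collected by an algorithm in at most `m` further queries from the history `l` on,
against the reward vectors `x`: every query of `S` contributes `c S`, and returning `S`
contributes `r S`. -/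
def runValue (A : Algorithm n p O U) (fb : Finset (Fin n) → Reward n → O)
    (c r : Finset (Fin n) → ℝ) (u : U) : ℕ → List O → (ℕ → Reward n) → ℝ
  -- The decision is still read when no query is left, so horizon `m` inspects the decisions at the
  -- times `0, …, m`.
  | 0, l, _ => (A.decision u l).elim 0 r
  | m + 1, l, x => (A.decision u l).elim
      (c (A.query u l) +
        A.runValue fb c r u m (l ++ [fb (A.query u l) (x 0)]) fun s => x (s + 1)) r

variable (A : Algorithm n p O U) (fb : Finset (Fin n) → Reward n → O)

lemma runValue_of_some {c r : Finset (Fin n) → ℝ} {u : U} {l : List O} {S : Finset (Fin n)}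
    (h : A.decision u l = some S) (m : ℕ) (x : ℕ → Reward n) :
    A.runValue fb c r u m l x = r S := by
  cases m <;> simp [runValue, h]

lemma runValue_zero_of_none {c r : Finset (Fin n) → ℝ} {u : U} {l : List O}
    (h : A.decision u l = none) (x : ℕ → Reward n) :
    A.runValue fb c r u 0 l x = 0 := by
  simp [runValue, h]

lemma runValue_succ_of_none {c r : Finset (Fin n) → ℝ} {u : U} {l : List O}
    (h : A.decision u l = none) (m : ℕ) (x : ℕ → Reward n) :
    A.runValue fb c r u (m + 1) l x = c (A.query u l) +
      A.runValue fb c r u m (l ++ [fb (A.query u l) (x 0)]) fun s => x (s + 1) := by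
  simp [runValue, h]

lemma runValue_add (c r c' r' : Finset (Fin n) → ℝ) (u : U) (m : ℕ) (l : List O)
    (x : ℕ → Reward n) :
    A.runValue fb (c + c') (r + r') u m l x =
      A.runValue fb c r u m l x + A.runValue fb c' r' u m l x := by
  induction m generalizing l x with
  | zero => cases h : A.decision u l <;> simp [runValue, h]
  | succ m ih =>
    cases h : A.decision u l
    · simp only [A.runValue_succ_of_none fb h, ih, Pi.add_apply]
      ring
    · simp [A.runValue_of_some fb h]

lemma runValue_smul (a : ℝ) (c r : Finset (Fin n) → ℝ) (u : U) (m : ℕ) (l : List O)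
    (x : ℕ → Reward n) :
    A.runValue fb (a • c) (a • r) u m l x = a * A.runValue fb c r u m l x := by
  induction m generalizing l x with
  | zero => cases h : A.decision u l <;> simp [runValue, h]
  | succ m ih =>
    cases h : A.decision u l
    · simp only [A.runValue_succ_of_none fb h, ih, Pi.smul_apply, smul_eq_mul]
      ring
    · simp [A.runValue_of_some fb h]

/-- Every query involves exactly `p` arms. -/
lemma sum_runValue_mem (u : U) (m : ℕ) (l : List O) (x : ℕ → Reward n) :
    ∑ j, A.runValue fb (fun S => if j ∈ S then 1 else 0) 0 u m l x =
      p * A.runValue fb 1 0 u m l x := by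
  induction m generalizing l x with
  | zero => cases h : A.decision u l <;> simp [runValue, h]
  | succ m ih =>
    cases h : A.decision u l
    · simp only [A.runValue_succ_of_none fb h, ih, Finset.sum_add_distrib]
      simp [A.card_query]
      ring
    · simp [A.runValue_of_some fb h]

lemma runValue_mono {c r c' r' : Finset (Fin n) → ℝ} (hc : c ≤ c') (hr : r ≤ r') (u : U) (m : ℕ)
    (l : List O) (x : ℕ → Reward n) :
    A.runValue fb c r u m l x ≤ A.runValue fb c' r' u m l x := by
  induction m generalizing l x with
  | zero =>
    cases h : A.decision u l
    · simp [runValue, h]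
    · simpa [runValue, h] using hr _
  | succ m ih =>
    cases h : A.decision u l
    · simp only [A.runValue_succ_of_none fb h]
      exact add_le_add (hc _) (ih _ _)
    · simpa [A.runValue_of_some fb h] using hr _

lemma abs_runValue_le {c r : Finset (Fin n) → ℝ} {K : ℝ} (hc : ∀ S, |c S| ≤ K)
    (hr : ∀ S, |r S| ≤ K) (u : U) (m : ℕ) (l : List O) (x : ℕ → Reward n) :
    |A.runValue fb c r u m l x| ≤ (m + 1) * K := by
  have hK : 0 ≤ K := (abs_nonneg _).trans (hc ∅)
  induction m generalizing l x with
  | zero => cases h : A.decision u l <;> simp [runValue, h, hK, hr]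
  | succ m ih =>
    cases h : A.decision u l
    · rw [A.runValue_succ_of_none fb h]
      refine (abs_add_le _ _).trans ((add_le_add (hc _) (ih _ _)).trans_eq ?_)
      push_cast
      ring
    · rw [A.runValue_of_some fb h]
      refine (hr _).trans ?_
      push_cast
      nlinarith [(Nat.cast_nonneg m : (0 : ℝ) ≤ m)]

lemma measurable_runValue (c r : Finset (Fin n) → ℝ) (m : ℕ) (l : List O) :
    Measurable fun z : U × (ℕ → Reward n) => A.runValue fb c r z.1 m l z.2 := by
  let _ : MeasurableSpace (Finset (Fin n)) := ⊤
  let _ : MeasurableSpace (Option (Finset (Fin n))) := ⊤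
  have : MeasurableSingletonClass (Finset (Fin n)) := ⟨fun _ => trivial⟩
  have : MeasurableSingletonClass (Option (Finset (Fin n))) := ⟨fun _ => trivial⟩
  have hdec : ∀ l, Measurable fun z : U × (ℕ → Reward n) => A.decision z.1 l := fun l =>
    (measurable_to_countable' fun d => A.measurableSet_decision l d).comp measurable_fst
  have hquery : ∀ l, Measurable fun z : U × (ℕ → Reward n) => A.query z.1 l := fun l =>
    (measurable_to_countable' fun d => A.measurableSet_query l d).comp measurable_fst
  induction m generalizing l with
  | zero =>
    exact (measurable_of_finite fun d : Option (Finset (Fin n)) => d.elim 0 r).comp (hdec l)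
  | succ m ih =>
    -- Decision, query and first reward vector range over finite types, so it suffices to fix them
    -- and treat the remaining run by induction.
    have hG : Measurable fun w : (Option (Finset (Fin n)) × Finset (Fin n) × Reward n) ×
        (U × (ℕ → Reward n)) => w.1.1.elim (c w.1.2.1 +
          A.runValue fb c r w.2.1 m (l ++ [fb w.1.2.1 w.1.2.2]) w.2.2) r := by
      refine measurable_from_prod_countable_right ?_
      rintro ⟨d, S, y⟩
      cases d with
      | none => exact (ih (l ++ [fb S y])).const_add (c S)
      | some d => exact measurable_const
    exact hG.comp (((hdec l).prodMk ((hquery l).prodMk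
      ((measurable_pi_apply 0).comp measurable_snd))).prodMk
      (measurable_fst.prodMk (measurable_shift.comp measurable_snd)))

instance (ρ : Measure U) [IsProbabilityMeasure ρ] (μ : Fin n → I) :
    IsProbabilityMeasure (law ρ μ) := by
  unfold law; infer_instance

lemma integrable_runValue (c r : Finset (Fin n) → ℝ) (m : ℕ) (l : List O)
    (P : Measure (U × (ℕ → Reward n))) [IsFiniteMeasure P] :
    Integrable (fun z => A.runValue fb c r z.1 m l z.2) P := by
  obtain ⟨K, hK⟩ := (Set.finite_range fun S => max |c S| |r S|).bddAbove
  refine .of_bound (A.measurable_runValue fb c r m l).aestronglyMeasurable ((m + 1) * K)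
    (ae_of_all _ fun z => A.abs_runValue_le fb (fun S => ?_) (fun S => ?_) _ _ _ _)
  · exact (le_max_left _ _).trans (hK ⟨S, rfl⟩)
  · exact (le_max_right _ _).trans (hK ⟨S, rfl⟩)

lemma integrable_runValue_right (c r : Finset (Fin n) → ℝ) (u : U) (m : ℕ) (l : List O)
    (P : Measure (ℕ → Reward n)) [IsFiniteMeasure P] :
    Integrable (fun x => A.runValue fb c r u m l x) P := by
  obtain ⟨K, hK⟩ := (Set.finite_range fun S => max |c S| |r S|).bddAbove
  refine .of_bound ((A.measurable_runValue fb c r m l).comp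
    measurable_prodMk_left).aestronglyMeasurable ((m + 1) * K)
    (ae_of_all _ fun z => A.abs_runValue_le fb (fun S => ?_) (fun S => ?_) _ _ _ _)
  · exact (le_max_left _ _).trans (hK ⟨S, rfl⟩)
  · exact (le_max_right _ _).trans (hK ⟨S, rfl⟩)

/-- The expectation of `runValue` given the seed. -/
def seedValue (c r : Finset (Fin n) → ℝ) (μ : Fin n → I) (u : U) (m : ℕ) (l : List O) : ℝ :=
  ∫ x, A.runValue fb c r u m l x ∂(Measure.infinitePi fun _ : ℕ => armLaw μ)

/-- The expectation of `runValue` from the empty history on. -/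
def meanValue (c r : Finset (Fin n) → ℝ) (ρ : Measure U) (μ : Fin n → I) (m : ℕ) : ℝ :=
  ∫ z, A.runValue fb c r z.1 m [] z.2 ∂(law ρ μ)

lemma seedValue_of_some {c r : Finset (Fin n) → ℝ} {μ : Fin n → I} {u : U} {l : List O}
    {S : Finset (Fin n)} (h : A.decision u l = some S) (m : ℕ) :
    A.seedValue fb c r μ u m l = r S := by
  simp [seedValue, A.runValue_of_some fb h]

lemma seedValue_zero_of_none {c r : Finset (Fin n) → ℝ} {μ : Fin n → I} {u : U} {l : List O}
    (h : A.decision u l = none) :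
    A.seedValue fb c r μ u 0 l = 0 := by
  simp [seedValue, A.runValue_zero_of_none fb h]

/-- The dynamic programming equation: with the seed fixed, integrate over the first reward vector;
the later ones are again i.i.d. and independent of it. -/
lemma seedValue_succ_of_none {c r : Finset (Fin n) → ℝ} {μ : Fin n → I} {u : U} {l : List O}
    (h : A.decision u l = none) (m : ℕ) :
    A.seedValue fb c r μ u (m + 1) l = c (A.query u l) +
      ∫ y, A.seedValue fb c r μ u m (l ++ [fb (A.query u l) y]) ∂(armLaw μ) := by
  rw [seedValue, integral_infinitePi_cons _ (A.integrable_runValue_right fb c r u _ l _)]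
  have : ∀ y : Reward n, ∫ x, A.runValue fb c r u (m + 1) l
      (fun i => Nat.casesOn (motive := fun _ => Reward n) i y x)
        ∂(Measure.infinitePi fun _ : ℕ => armLaw μ) =
      c (A.query u l) + A.seedValue fb c r μ u m (l ++ [fb (A.query u l) y]) := by
    intro y
    simp only [A.runValue_succ_of_none fb h]
    refine (integral_add (integrable_const _)
      (A.integrable_runValue_right fb c r u m (l ++ [fb (A.query u l) y]) _)).trans ?_
    simp [seedValue]
  simp only [this]
  rw [integral_add (integrable_const _) (integrable_armLaw _ _)]
  simp

lemma seedValue_nonneg {c r : Finset (Fin n) → ℝ} (hc : 0 ≤ c) (hr : 0 ≤ r) (μ : Fin n → I)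
    (u : U) (m : ℕ) (l : List O) : 0 ≤ A.seedValue fb c r μ u m l := by
  refine integral_nonneg fun x => ?_
  have h0 := A.runValue_smul fb 0 0 0 u m l x
  simp only [zero_smul, zero_mul] at h0
  exact h0.ge.trans (A.runValue_mono fb hc hr u m l x)

lemma meanValue_eq_integral (c r : Finset (Fin n) → ℝ) (ρ : Measure U) [IsProbabilityMeasure ρ]
    (μ : Fin n → I) (m : ℕ) :
    A.meanValue fb c r ρ μ m = ∫ u, A.seedValue fb c r μ u m [] ∂ρ :=
  integral_prod _ (A.integrable_runValue fb c r m [] (law ρ μ))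

lemma integrable_seedValue (c r : Finset (Fin n) → ℝ) (ρ : Measure U) [IsProbabilityMeasure ρ]
    (μ : Fin n → I) (m : ℕ) (l : List O) :
    Integrable (fun u => A.seedValue fb c r μ u m l) ρ :=
  (A.integrable_runValue fb c r m l (law ρ μ)).integral_prod_left

/-! ### Change of measure along a run. -/

/-- If the change of means from `μ` to `μ'` costs at most `κ S` when `S` is queried, then the
expected cost under `μ` bounds the probability to stop under `μ'` from below. -/
lemma exp_seedValue_le {μ μ' : Fin n → I} {κ : Finset (Fin n) → ℝ}
    (hκ : ∀ S : Finset (Fin n), S.card = p → ∀ F : O → ℝ,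
      Real.exp (∫ x, F (fb S x) ∂(armLaw μ) - κ S) ≤ ∫ x, Real.exp (F (fb S x)) ∂(armLaw μ'))
    {η : ℝ} (hη : 0 < η) (u : U) (m : ℕ) (l : List O) :
    Real.exp (Real.log η + A.seedValue fb (-κ) (fun _ => -Real.log η) μ u m l) ≤
      A.seedValue fb 0 1 μ' u m l + η := by
  induction m generalizing l with
  | zero =>
    -- The test function is `0` on stopped runs and `log η` on the others; its exponential is at
    -- most the indicator of stopping plus `η`. The parameter `η > 0` stands in for `log 0`.
    cases h : A.decision u l
    · simp [A.seedValue_zero_of_none fb h, Real.exp_log hη]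
    · simp [A.seedValue_of_some fb h, hη.le]
  | succ m ih =>
    cases h : A.decision u l
    · rw [A.seedValue_succ_of_none fb h, A.seedValue_succ_of_none fb h]
      have hstep := hκ (A.query u l) (A.card_query u l) fun o =>
        Real.log η + A.seedValue fb (-κ) (fun _ => -Real.log η) μ u m (l ++ [o])
      rw [integral_add (integrable_const _) (integrable_armLaw _ _)] at hstep
      simp only [integral_const, probReal_univ, smul_eq_mul, one_mul] at hstep
      calc _ = _ := by
            congr 1
            simp only [Pi.neg_apply]
            ring
        _ ≤ _ := hstep
        _ ≤ ∫ x, (A.seedValue fb 0 1 μ' u m (l ++ [fb (A.query u l) x]) + η) ∂(armLaw μ') :=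
          integral_mono (integrable_armLaw _ _) (integrable_armLaw _ _) fun x => ih _
        _ = _ := by
          rw [integral_add (integrable_armLaw _ _) (integrable_const _)]
          simp
    · simp [A.seedValue_of_some fb h, hη.le]

lemma exp_meanValue_le {μ μ' : Fin n → I} {κ : Finset (Fin n) → ℝ}
    (hκ : ∀ S : Finset (Fin n), S.card = p → ∀ F : O → ℝ,
      Real.exp (∫ x, F (fb S x) ∂(armLaw μ) - κ S) ≤ ∫ x, Real.exp (F (fb S x)) ∂(armLaw μ'))
    {η : ℝ} (hη : 0 < η) (ρ : Measure U) [IsProbabilityMeasure ρ] (m : ℕ) :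
    Real.exp (Real.log η + A.meanValue fb (-κ) (fun _ => -Real.log η) ρ μ m) ≤
      A.meanValue fb 0 1 ρ μ' m + η := by
  have hint := A.integrable_seedValue fb (-κ) (fun _ => -Real.log η) ρ μ m []
  have hint' := A.integrable_seedValue fb 0 1 ρ μ' m []
  rw [meanValue_eq_integral, meanValue_eq_integral]
  set y := Real.log η + ∫ u, A.seedValue fb (-κ) (fun _ => -Real.log η) μ u m [] ∂ρ with hy
  -- Jensen over the seed via the tangent of `exp` at the mean `y`, which requires integrability of
  -- the exponent only.
  have hpt : ∀ u, Real.exp y * (1 + Real.log η - y) +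
      Real.exp y * A.seedValue fb (-κ) (fun _ => -Real.log η) μ u m [] ≤
      A.seedValue fb 0 1 μ' u m [] + η := by
    intro u
    refine le_trans ?_ (A.exp_seedValue_le fb hκ hη u m [])
    calc _ = Real.exp y * ((Real.log η +
          A.seedValue fb (-κ) (fun _ => -Real.log η) μ u m [] - y) + 1) := by ring
      _ ≤ Real.exp y * Real.exp (Real.log η +
          A.seedValue fb (-κ) (fun _ => -Real.log η) μ u m [] - y) := by
            gcongr
            exact Real.add_one_le_exp _
      _ = _ := by rw [← Real.exp_add]; congr 1; ring
  have h := integral_mono (μ := ρ) ((integrable_const _).add (hint.const_mul _))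
    (hint'.add (integrable_const _)) hpt
  simp only [Pi.add_apply] at h
  rw [integral_add (integrable_const _) (hint.const_mul _), integral_const_mul,
    integral_add hint' (integrable_const _)] at h
  simp only [integral_const, probReal_univ, smul_eq_mul, one_mul] at h
  refine le_trans (le_of_eq ?_) h
  rw [integral_const_mul, ← mul_add]
  linear_combination Real.exp y * hy

/-- Each query contributes one factor `c ^ n` from the comparison of single draws. For a fixed
horizon the total factor tends to `1` as `c → 1`. -/
lemma seedValue_le_of_le {μ μ' : Fin n → I} {c : ℝ} (hc : 1 ≤ c) (hle : ∀ i, μ i ≤ μ' i)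
    (hc' : ∀ i, 1 - (μ i : ℝ) ≤ c * (1 - μ' i)) {r : Finset (Fin n) → ℝ} (hr : 0 ≤ r)
    (u : U) (m : ℕ) (l : List O) :
    A.seedValue fb 0 r μ u m l ≤ (c ^ n) ^ m * A.seedValue fb 0 r μ' u m l := by
  have hcm : ∀ m : ℕ, 1 ≤ (c ^ n) ^ m := fun m => one_le_pow₀ (one_le_pow₀ hc)
  induction m generalizing l with
  | zero =>
    cases h : A.decision u l
    · simp [A.seedValue_zero_of_none fb h]
    · simp [A.seedValue_of_some fb h]
  | succ m ih =>
    cases h : A.decision u l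
    · rw [A.seedValue_succ_of_none fb h, A.seedValue_succ_of_none fb h]
      simp only [Pi.zero_apply, zero_add]
      calc _ ≤ ∫ y, (c ^ n) ^ m * A.seedValue fb 0 r μ' u m (l ++ [fb (A.query u l) y])
            ∂(armLaw μ) :=
          integral_mono (integrable_armLaw _ _) (integrable_armLaw _ _) fun x => ih _
        _ ≤ c ^ n * ∫ y, (c ^ n) ^ m * A.seedValue fb 0 r μ' u m (l ++ [fb (A.query u l) y])
            ∂(armLaw μ') :=
          integral_armLaw_le_of_le hc hle hc' fun y =>
            mul_nonneg (by linarith [hcm m]) (A.seedValue_nonneg fb le_rfl hr _ _ _ _)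
        _ = _ := by
          rw [integral_const_mul]
          ring
    · rw [A.seedValue_of_some fb h, A.seedValue_of_some fb h]
      nlinarith [hcm (m + 1), hr ‹_›, show (0 : Finset (Fin n) → ℝ) ‹_› = 0 from rfl]

lemma meanValue_le_of_le {μ μ' : Fin n → I} {c : ℝ} (hc : 1 ≤ c) (hle : ∀ i, μ i ≤ μ' i)
    (hc' : ∀ i, 1 - (μ i : ℝ) ≤ c * (1 - μ' i)) {r : Finset (Fin n) → ℝ} (hr : 0 ≤ r)
    (ρ : Measure U) [IsProbabilityMeasure ρ] (m : ℕ) :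
    A.meanValue fb 0 r ρ μ m ≤ (c ^ n) ^ m * A.meanValue fb 0 r ρ μ' m := by
  rw [meanValue_eq_integral, meanValue_eq_integral, ← integral_const_mul]
  exact integral_mono (A.integrable_seedValue fb _ _ _ _ _ _)
    ((A.integrable_seedValue fb _ _ _ _ _ _).const_mul _)
    fun u => A.seedValue_le_of_le fb hc hle hc' hr u m []

end Algorithm

/-! ### Truncated runs, stopping time and returned set. -/

namespace Algorithm

variable {n p : ℕ} {O U : Type*} [MeasurableSpace U]
  (A : Algorithm n p O U) (fb : Finset (Fin n) → Reward n → O)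

lemma runValue_history_succ {c r : Finset (Fin n) → ℝ} {u : U} {x : ℕ → Reward n} {t : ℕ}
    (h : A.decision u (A.history fb u x t) = none) (m : ℕ) :
    A.runValue fb c r u (m + 1) (A.history fb u x t) (fun s => x (s + t)) =
      c (A.query u (A.history fb u x t)) +
        A.runValue fb c r u m (A.history fb u x (t + 1)) (fun s => x (s + (t + 1))) := by
  rw [A.runValue_succ_of_none fb h]
  simp only [history, zero_add, add_assoc, add_comm 1 t]

lemma runValue_queries_le {u : U} {x : ℕ → Reward n} {s : ℕ}
    (hs : (A.decision u (A.history fb u x s)).isSome) (m t : ℕ)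
    (ht : ∀ i < t, A.decision u (A.history fb u x i) = none) :
    t + A.runValue fb 1 0 u m (A.history fb u x t) (fun i => x (i + t)) ≤ s := by
  have hts : (t : ℝ) ≤ s := by
    refine Nat.cast_le.2 (not_lt.1 fun hlt => ?_)
    simp [ht s hlt] at hs
  induction m generalizing t with
  | zero =>
    cases h : A.decision u (A.history fb u x t)
    · simpa [A.runValue_zero_of_none fb h] using hts
    · simpa [A.runValue_of_some fb h] using hts
  | succ m ih =>
    cases h : A.decision u (A.history fb u x t)
    · rw [A.runValue_history_succ fb h]
      have ht' : ∀ i < t + 1, A.decision u (A.history fb u x i) = none := fun i hi =>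
        (Nat.lt_succ_iff_lt_or_eq.1 hi).elim (ht i) fun e => e ▸ h
      have hts' : ((t + 1 : ℕ) : ℝ) ≤ s := by
        refine Nat.cast_le.2 (not_lt.1 fun hlt => ?_)
        simp [ht' s hlt] at hs
      have := ih (t + 1) ht' hts'
      push_cast at this
      simp only [Pi.one_apply]
      linarith
    · simpa [A.runValue_of_some fb h] using hts

lemma runValue_termination_eq_one {u : U} {x : ℕ → Reward n} {s : ℕ}
    (hs : (A.decision u (A.history fb u x s)).isSome) (m t : ℕ)
    (ht : ∀ i < t, A.decision u (A.history fb u x i) = none) (hsm : s ≤ t + m) :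
    A.runValue fb 0 1 u m (A.history fb u x t) (fun i => x (i + t)) = 1 := by
  have hts : ¬ s < t := fun hlt => by simp [ht s hlt] at hs
  induction m generalizing t with
  | zero =>
    obtain rfl : s = t := by omega
    obtain ⟨S, hS⟩ := Option.isSome_iff_exists.1 hs
    simp [A.runValue_of_some fb hS]
  | succ m ih =>
    cases h : A.decision u (A.history fb u x t)
    · rw [A.runValue_history_succ fb h]
      have ht' : ∀ i < t + 1, A.decision u (A.history fb u x i) = none := fun i hi =>
        (Nat.lt_succ_iff_lt_or_eq.1 hi).elim (ht i) fun e => e ▸ h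
      simpa using ih (t + 1) ht' (by omega) fun hlt => by simp [ht' s hlt] at hs
    · simp [A.runValue_of_some fb h]

lemma runValue_of_returns {u : U} {x : ℕ → Reward n} {S : Finset (Fin n)} {s : ℕ}
    (hs : A.decision u (A.history fb u x s) = some S)
    (hs' : ∀ i < s, A.decision u (A.history fb u x i) = none)
    {r : Finset (Fin n) → ℝ} (hr : r S = 0) (m t : ℕ) (hts : t ≤ s) :
    A.runValue fb 0 r u m (A.history fb u x t) (fun i => x (i + t)) = 0 := by
  rcases hts.eq_or_lt with rfl | hlt
  · rw [A.runValue_of_some fb hs, hr]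
  · induction m generalizing t with
    | zero => exact A.runValue_zero_of_none fb (hs' t hlt) _
    | succ m ih =>
      rw [A.runValue_history_succ fb (hs' t hlt)]
      rcases (Nat.succ_le_of_lt hlt).eq_or_lt with h | h
      · rw [A.runValue_of_some fb (S := S) (by rw [← hs, ← h])]
        simpa using hr
      · simpa using ih (t + 1) h.le h

lemma numQueries_eq (u : U) (x : ℕ → Reward n) :
    A.numQueries fb u x = ⊤ ∨ ∃ s : ℕ, A.numQueries fb u x = s ∧
      (A.decision u (A.history fb u x s)).isSome := by
  by_cases h : ∃ s, (A.decision u (A.history fb u x s)).isSome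
  · refine .inr ⟨Nat.find h, le_antisymm
      (iInf₂_le (f := fun (t : ℕ) _ => (t : ℕ∞)) (Nat.find h) (Nat.find_spec h)) ?_, Nat.find_spec h⟩
    exact le_iInf₂ fun t ht => Nat.cast_le.2 (Nat.find_min' h ht)
  · refine .inl (iInf₂_eq_top.2 fun t ht => absurd ⟨t, ht⟩ h)

lemma ofReal_le_numQueries {u : U} {x : ℕ → Reward n} {a : ℝ}
    (h : ∀ s : ℕ, (A.decision u (A.history fb u x s)).isSome → a ≤ s) :
    ENNReal.ofReal a ≤ (A.numQueries fb u x : ℝ≥0∞) := by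
  rcases A.numQueries_eq fb u x with hq | ⟨s, hq, hs⟩
  · simp [hq]
  · rw [hq]
    refine (ENNReal.ofReal_le_ofReal (h s hs)).trans ?_
    simp

/-- The integrable minorant `g` makes measurability of `numQueries` unnecessary. -/
lemma integral_le_expectedQueries (ρ : Measure U) (μ : Fin n → I)
    (hfin : A.expectedQueries fb ρ μ ≠ ⊤)
    {g : U × (ℕ → Reward n) → ℝ} (hg : Integrable g (law ρ μ)) (hg0 : ∀ z, 0 ≤ g z)
    (h : ∀ z, ∀ s : ℕ, (A.decision z.1 (A.history fb z.1 z.2 s)).isSome → g z ≤ s) :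
    ∫ z, g z ∂(law ρ μ) ≤ (A.expectedQueries fb ρ μ).toReal := by
  rw [← ENNReal.ofReal_le_iff_le_toReal hfin,
    ofReal_integral_eq_lintegral_ofReal hg (ae_of_all _ hg0)]
  exact lintegral_mono fun z => A.ofReal_le_numQueries fb (h z)

lemma runValue_zero_zero (u : U) (m : ℕ) (l : List O) (x : ℕ → Reward n) :
    A.runValue fb 0 0 u m l x = 0 := by
  have h0 := A.runValue_smul fb 0 0 0 u m l x
  simpa only [zero_smul, zero_mul] using h0

lemma runValue_nonneg {c r : Finset (Fin n) → ℝ} (hc : 0 ≤ c) (hr : 0 ≤ r)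
    (u : U) (m : ℕ) (l : List O) (x : ℕ → Reward n) : 0 ≤ A.runValue fb c r u m l x :=
  (A.runValue_zero_zero fb u m l x).ge.trans (A.runValue_mono fb hc hr u m l x)

variable (ρ : Measure U) [IsProbabilityMeasure ρ] (μ : Fin n → I)

lemma meanValue_queries_le (hfin : A.expectedQueries fb ρ μ ≠ ⊤) (m : ℕ) :
    A.meanValue fb 1 0 ρ μ m ≤ (A.expectedQueries fb ρ μ).toReal := by
  refine A.integral_le_expectedQueries fb ρ μ hfin (A.integrable_runValue fb _ _ _ _ _)
    (fun z => A.runValue_nonneg fb zero_le_one le_rfl _ _ _ _) fun z s hs => ?_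
  simpa [history] using A.runValue_queries_le fb hs m 0 (by simp)

lemma runValue_termination_le_one (u : U) (m : ℕ) (l : List O) (x : ℕ → Reward n) :
    A.runValue fb 0 1 u m l x ≤ 1 := by
  induction m generalizing l x with
  | zero => cases h : A.decision u l <;> simp [runValue, h]
  | succ m ih =>
    cases h : A.decision u l
    · simpa [A.runValue_succ_of_none fb h] using ih _ _
    · simp [A.runValue_of_some fb h]

/-- Markov's inequality: a run not stopped at any of the times `0, …, m` makes at least `m + 1`
queries. -/
lemma one_sub_meanValue_termination_le (hfin : A.expectedQueries fb ρ μ ≠ ⊤) (m : ℕ) :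
    1 - A.meanValue fb 0 1 ρ μ m ≤ (A.expectedQueries fb ρ μ).toReal / (m + 1) := by
  have hint := A.integrable_runValue fb 0 1 m [] (law ρ μ)
  have hm : (0 : ℝ) < m + 1 := by positivity
  rw [le_div_iff₀ hm, mul_comm]
  have := A.integral_le_expectedQueries fb ρ μ hfin
    (g := fun z => (m + 1) * (1 - A.runValue fb 0 1 z.1 m [] z.2))
    (((integrable_const 1).sub hint).const_mul _)
    (fun z => mul_nonneg hm.le (sub_nonneg.2 (A.runValue_termination_le_one fb _ _ _ _))) ?_
  · rw [integral_const_mul, integral_sub (integrable_const _) hint] at this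
    simpa [meanValue] using this
  · intro z s hs
    by_cases hsm : s ≤ m
    · have := A.runValue_termination_eq_one fb hs m 0 (by simp) (by simpa using hsm)
      simp only [history, add_zero] at this
      simp [this]
    · have h0 := A.runValue_nonneg fb le_rfl zero_le_one z.1 m [] z.2
      have : ((m + 1 : ℕ) : ℝ) ≤ s := Nat.cast_le.2 (by omega)
      push_cast at this
      nlinarith

/-! ### Instances with ties. -/

variable {A fb ρ}

lemma IdentifiesTop.meanValue_ne_le {k : ℕ} {δ : ℝ} (hA : A.IdentifiesTop fb ρ k δ)
    {μ : Fin n → I} (hμ : ∀ i, μ i < 1) {S : Finset (Fin n)} (hS : IsTopSet k μ S) (m : ℕ) :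
    A.meanValue fb 0 (fun S' => if S' = S then 0 else 1) ρ μ m ≤ δ := by
  set r : Finset (Fin n) → ℝ := fun S' => if S' = S then 0 else 1 with hr
  have hr1 : r ≤ 1 := fun S' => by simp only [hr]; split_ifs <;> simp
  have hr0 : 0 ≤ r := fun S' => by simp only [hr]; split_ifs <;> simp
  set g : U × (ℕ → Reward n) → ℝ := fun z => A.runValue fb 0 r z.1 m [] z.2 with hg
  have hgm : Measurable g := A.measurable_runValue fb 0 r m []
  have hE : MeasurableSet {z | g z = 0} := hgm (measurableSet_singleton 0)
  -- The event of returning `S` is replaced by a measurable superset.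
  have hsub : {ω : U × (ℕ → Reward n) | A.Returns fb ω.1 ω.2 S} ⊆ {z | g z = 0} := by
    rintro ω ⟨s, hs, hs'⟩
    exact A.runValue_of_returns fb hs hs' (r := r) (by simp [hr]) m 0 (Nat.zero_le s)
  have hprob : 1 - δ ≤ (law ρ μ).real {z | g z = 0} := by
    rw [measureReal_def, ← ENNReal.ofReal_le_iff_le_toReal (measure_ne_top _ _)]
    exact (hA μ hμ S hS).trans (measure_mono hsub)
  calc ∫ z, g z ∂(law ρ μ) ≤ ∫ z, ({z | g z = 0}ᶜ.indicator 1 z : ℝ) ∂(law ρ μ) := by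
        refine integral_mono (A.integrable_runValue fb 0 r m [] _)
          ((integrable_const (1 : ℝ)).indicator hE.compl) fun z => ?_
        by_cases hz : g z = 0
        · simp [hz]
        · have h1 : g z ≤ 1 := (A.runValue_mono fb le_rfl hr1 z.1 m [] z.2).trans
            (A.runValue_termination_le_one fb _ _ _ _)
          simpa [Set.indicator, hz] using h1
    _ = 1 - (law ρ μ).real {z | g z = 0} := by
        rw [integral_indicator_one hE.compl, probReal_compl_eq_one_sub hE]
    _ ≤ δ := by linarith

/-- The bound of `IdentifiesTop.meanValue_ne_le` persists for sets that are among the top sets of an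
instance with ties: raising the means in `S` slightly breaks the tie in favour of `S`. -/
lemma IdentifiesTop.meanValue_ne_le_of_tie {k : ℕ} {δ : ℝ} (hA : A.IdentifiesTop fb ρ k δ)
    {μ : Fin n → I} (hμ : ∀ i, μ i < 1) {S : Finset (Fin n)} (hcard : S.card = k)
    (hS : ∀ i ∈ S, ∀ j ∉ S, μ j ≤ μ i) (m : ℕ) :
    A.meanValue fb 0 (fun S' => if S' = S then 0 else 1) ρ μ m ≤ δ := by
  set r : Finset (Fin n) → ℝ := fun S' => if S' = S then 0 else 1 with hr
  have hr0 : 0 ≤ r := fun S' => by simp only [hr]; split_ifs <;> simp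
  have hbound : ∀ c : ℝ, 1 < c → A.meanValue fb 0 r ρ μ m ≤ (c ^ n) ^ m * δ := by
    intro c hc
    have hc0 : 0 < c := by linarith
    have hq : ∀ i, 0 < 1 - (μ i : ℝ) := fun i => sub_pos.2 (hμ i)
    have hdiv : ∀ i, (1 - (μ i : ℝ)) / c < 1 - μ i := fun i => div_lt_self (hq i) hc
    -- On `S`, `1 - μ'` is `(1 - μ) / c`. The means stay below `1`, and raising them, unlike
    -- lowering, also works for arms of mean `0`.
    let μ' : Fin n → I := fun i => if i ∈ S then
      ⟨1 - (1 - (μ i : ℝ)) / c, by linarith [hdiv i, (μ i).2.1], by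
        linarith [div_pos (hq i) hc0]⟩ else μ i
    have hin : ∀ i ∈ S, (μ' i : ℝ) = 1 - (1 - (μ i : ℝ)) / c := fun i hi => by simp [μ', hi]
    have hout : ∀ i ∉ S, μ' i = μ i := fun i hi => by simp [μ', hi]
    have htop : IsTopSet k μ' S := by
      refine ⟨hcard, fun i hi j hj => ?_⟩
      rw [hout j hj]
      refine (hS i hi j hj).trans_lt (Subtype.coe_lt_coe.1 ?_)
      rw [hin i hi]
      linarith [hdiv i]
    have hμ' : ∀ i, μ' i < 1 := by
      intro i
      by_cases hi : i ∈ S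
      · refine Subtype.coe_lt_coe.1 ?_
        rw [hin i hi]
        have := div_pos (hq i) hc0
        simp only [Set.Icc.coe_one]
        linarith
      · rw [hout i hi]; exact hμ i
    refine (A.meanValue_le_of_le fb (μ' := μ') hc.le (fun i => ?_) (fun i => ?_) hr0 ρ m).trans
      (mul_le_mul_of_nonneg_left (hA.meanValue_ne_le hμ' htop m) (by positivity))
    · by_cases hi : i ∈ S
      · refine Subtype.coe_le_coe.1 ?_
        rw [hin i hi]
        linarith [hdiv i]
      · rw [hout i hi]
    · by_cases hi : i ∈ S
      · rw [hin i hi]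
        field_simp
        linarith
      · rw [hout i hi]
        nlinarith [hq i]
  have hlim : Filter.Tendsto (fun c : ℝ => (c ^ n) ^ m * δ) (nhdsWithin 1 (Set.Ioi 1))
      (nhds δ) := by
    have : Continuous fun c : ℝ => (c ^ n) ^ m * δ := by fun_prop
    simpa using (this.tendsto 1).mono_left nhdsWithin_le_nhds
  exact ge_of_tendsto hlim (eventually_nhdsWithin_of_forall hbound)

/-- A run that stops returns a set different from `S` or different from `T`, and each of these has
probability at most `δ`. -/
lemma IdentifiesTop.meanValue_termination_le {k : ℕ} {δ : ℝ} (hA : A.IdentifiesTop fb ρ k δ)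
    {μ : Fin n → I} (hμ : ∀ i, μ i < 1) {S T : Finset (Fin n)} (hST : S ≠ T)
    (hScard : S.card = k) (hS : ∀ i ∈ S, ∀ j ∉ S, μ j ≤ μ i)
    (hTcard : T.card = k) (hT : ∀ i ∈ T, ∀ j ∉ T, μ j ≤ μ i) (m : ℕ) :
    A.meanValue fb 0 1 ρ μ m ≤ 2 * δ := by
  have h1 := hA.meanValue_ne_le_of_tie hμ hScard hS m
  have h2 := hA.meanValue_ne_le_of_tie hμ hTcard hT m
  refine le_trans ?_ ((add_le_add h1 h2).trans_eq (two_mul δ).symm)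
  unfold meanValue
  rw [← integral_add (A.integrable_runValue fb _ _ _ _ _) (A.integrable_runValue fb _ _ _ _ _)]
  refine integral_mono (A.integrable_runValue fb _ _ _ _ _)
    ((A.integrable_runValue fb _ _ _ _ _).add (A.integrable_runValue fb _ _ _ _ _)) fun z => ?_
  rw [← A.runValue_add fb]
  refine A.runValue_mono fb (by simp) (fun S' => ?_) _ _ _ _
  simp only [Pi.one_apply, Pi.add_apply]
  by_cases h : S' = S
  · simp [h, hST]
  · simp only [h, if_false]
    split_ifs <;> simp

/-! ### From single arms to the lower bound. -/

/-- The lower bound on the expected number of queries of arm `j`. -/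
lemma two_mul_mul_le_meanValue {μ μ' : Fin n → I} (hfin : A.expectedQueries fb ρ μ ≠ ⊤) {β : ℝ}
    (hβ : 0 < β) (j : Fin n) {τ : ℝ} (hτ : 0 < τ)
    (hκ : ∀ S : Finset (Fin n), S.card = p → ∀ F : O → ℝ,
      Real.exp (∫ x, F (fb S x) ∂(armLaw μ) - if j ∈ S then 1 / (2 * τ) else 0) ≤
        ∫ x, Real.exp (F (fb S x)) ∂(armLaw μ'))
    {η : ℝ} (hη : 0 < η) (hη1 : η < 1) (m : ℕ) (hterm : A.meanValue fb 0 1 ρ μ' m ≤ β) :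
    2 * τ * (Real.log η * ((A.expectedQueries fb ρ μ).toReal / (m + 1)) - Real.log (β + η)) ≤
      A.meanValue fb (fun S => if j ∈ S then 1 else 0) 0 ρ μ m := by
  set N := A.meanValue fb (fun S => if j ∈ S then 1 else 0) 0 ρ μ m with hN
  set V := A.meanValue fb 0 1 ρ μ m with hV
  have hlin : A.meanValue fb (-fun S => if j ∈ S then 1 / (2 * τ) else 0)
      (fun _ => -Real.log η) ρ μ m = -(1 / (2 * τ)) * N + -Real.log η * V := by
    rw [hN, hV]
    unfold meanValue
    rw [← integral_const_mul, ← integral_const_mul, ← integral_add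
      ((A.integrable_runValue fb _ _ _ _ _).const_mul _)
      ((A.integrable_runValue fb _ _ _ _ _).const_mul _)]
    refine integral_congr_ae (ae_of_all _ fun z => ?_)
    simp only
    rw [← A.runValue_smul fb, ← A.runValue_smul fb, ← A.runValue_add fb]
    congr 1
    · ext S
      by_cases h : j ∈ S <;> simp [h]
    · ext S
      simp
  have hexp := (A.exp_meanValue_le fb hκ hη ρ m).trans (add_le_add_left hterm η)
  rw [hlin, ← Real.le_log_iff_exp_le (by linarith)] at hexp
  have hV1 := A.one_sub_meanValue_termination_le fb ρ μ hfin m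
  have hlog : Real.log η < 0 := Real.log_neg hη hη1
  have h1 := mul_le_mul_of_nonpos_left hV1 hlog.le
  rw [← hV] at h1
  have h2 : Real.log η * ((A.expectedQueries fb ρ μ).toReal / (m + 1)) - Real.log (β + η) ≤
      1 / (2 * τ) * N := by linarith
  calc _ ≤ 2 * τ * (1 / (2 * τ) * N) := mul_le_mul_of_nonneg_left h2 (by linarith)
    _ = N := by field_simp

/-- Reduction of the lower bound to single arms: for every `j` with `τ j > 0` there is an instance
with two top sets, where replacing `μ` by this instance costs at most `1 / (2 * τ j)` per query
of `j`. -/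
lemma IdentifiesTop.lowerBound_le {k : ℕ} {δ : ℝ} (hA : A.IdentifiesTop fb ρ k δ) (hδ : 0 < δ)
    (hp : 1 ≤ p) (hn : 0 < n) {μ : Fin n → I} {τ : Fin n → ℝ} (hτ : ∀ j, 0 ≤ τ j)
    (h : ∀ j, 0 < τ j → ∃ μ' : Fin n → I, (∀ i, μ' i < 1) ∧
      (∃ S T : Finset (Fin n), S ≠ T ∧ S.card = k ∧ (∀ i ∈ S, ∀ j ∉ S, μ' j ≤ μ' i) ∧
        T.card = k ∧ (∀ i ∈ T, ∀ j ∉ T, μ' j ≤ μ' i)) ∧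
      ∀ S : Finset (Fin n), S.card = p → ∀ F : O → ℝ,
        Real.exp (∫ x, F (fb S x) ∂(armLaw μ) - if j ∈ S then 1 / (2 * τ j) else 0) ≤
          ∫ x, Real.exp (F (fb S x)) ∂(armLaw μ')) :
    ENNReal.ofReal (lowerBound p δ τ) ≤ A.expectedQueries fb ρ μ := by
  by_cases hfin : A.expectedQueries fb ρ μ = ⊤
  · simp [hfin]
  rw [ENNReal.ofReal_le_iff_le_toReal hfin]
  set E := (A.expectedQueries fb ρ μ).toReal
  have : Nonempty (Fin n) := ⟨⟨0, hn⟩⟩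
  have hp0 : (0 : ℝ) < p := by exact_mod_cast hp
  set K := (⨆ j, τ j) + 1 / (p : ℝ) * ∑ j, τ j
  have hfinite : ∀ η : ℝ, 0 < η → η < 1 → ∀ m : ℕ,
      K * (Real.log η * (E / (m + 1)) - Real.log (2 * δ + η)) ≤ E := by
    intro η hη hη1 m
    set L := Real.log η * (E / (m + 1)) - Real.log (2 * δ + η)
    have hE := A.meanValue_queries_le fb ρ μ hfin m
    have harm : ∀ j, 2 * τ j * L ≤ A.meanValue fb (fun S => if j ∈ S then 1 else 0) 0 ρ μ m := by
      intro j
      rcases (hτ j).eq_or_lt with h0 | hpos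
      · rw [← h0]
        simp only [mul_zero, zero_mul]
        refine integral_nonneg fun z => A.runValue_nonneg fb (fun S => ?_) le_rfl _ _ _ _
        simp only
        split_ifs <;> simp
      · obtain ⟨μ', hμ', ⟨S, T, hST, hS, hS', hT, hT'⟩, hκ⟩ := h j hpos
        exact two_mul_mul_le_meanValue hfin (by linarith) j hpos hκ hη hη1 m
          (hA.meanValue_termination_le hμ' hST hS hS' hT hT' m)
    have hmax : 2 * (⨆ j, τ j) * L ≤ E := by
      obtain ⟨j, hj⟩ := exists_eq_ciSup_of_finite (f := τ)
      rw [← hj]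
      refine (harm j).trans (le_trans ?_ hE)
      refine integral_mono (A.integrable_runValue fb _ _ _ _ _)
        (A.integrable_runValue fb _ _ _ _ _) fun z =>
          A.runValue_mono fb (fun S => ?_) le_rfl _ _ _ _
      simp only [Pi.one_apply]
      split_ifs <;> simp
    have hsum : 2 * (∑ j, τ j) * L ≤ p * E := by
      calc 2 * (∑ j, τ j) * L = ∑ j, 2 * τ j * L := by rw [Finset.mul_sum, Finset.sum_mul]
        _ ≤ ∑ j, A.meanValue fb (fun S => if j ∈ S then 1 else 0) 0 ρ μ m :=
          Finset.sum_le_sum fun j _ => harm j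
        _ = p * A.meanValue fb 1 0 ρ μ m := by
          unfold meanValue
          rw [← integral_finsetSum _ fun j _ => A.integrable_runValue fb _ _ _ _ _,
            ← integral_const_mul]
          simp only [A.sum_runValue_mem fb]
        _ ≤ p * E := mul_le_mul_of_nonneg_left hE hp0.le
    have hsum' : 2 * (1 / (p : ℝ) * ∑ j, τ j) * L ≤ E := by
      calc _ = 2 * (∑ j, τ j) * L / p := by ring
        _ ≤ E := (div_le_iff₀ hp0).2 (by linarith)
    -- `K` is half the sum of the two coefficients `2 * max τ` and `(2 / p) * ∑ τ`.
    calc K * L = (2 * (⨆ j, τ j) * L + 2 * (1 / (p : ℝ) * ∑ j, τ j) * L) / 2 := by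
          simp only [K]; ring
      _ ≤ E := by linarith
  -- The limits come in this order: `m → ∞` removes the unstopped runs, weighted by `log η`, and
  -- only then can `η` tend to `0`.
  have hη : ∀ η : ℝ, 0 < η → η < 1 → K * (-Real.log (2 * δ + η)) ≤ E := by
    intro η h0 h1
    have hlim : Filter.Tendsto
        (fun m : ℕ => K * (Real.log η * (E / (m + 1)) - Real.log (2 * δ + η))) Filter.atTop
        (nhds (K * (Real.log η * 0 - Real.log (2 * δ + η)))) := by
      refine ((Filter.Tendsto.const_mul _ ?_).sub_const _).const_mul _
      have := (tendsto_one_div_add_atTop_nhds_zero_nat (𝕜 := ℝ)).const_mul E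
      simpa [div_eq_mul_inv] using this
    have := le_of_tendsto' hlim (hfinite η h0 h1)
    simpa using this
  have hlim : Filter.Tendsto (fun η : ℝ => K * (-Real.log (2 * δ + η)))
      (nhdsWithin 0 (Set.Ioi 0)) (nhds (K * (-Real.log (2 * δ + 0)))) := by
    have : ContinuousAt (fun η : ℝ => K * (-Real.log (2 * δ + η))) 0 := by
      refine ContinuousAt.mul continuousAt_const (ContinuousAt.neg (ContinuousAt.log ?_ ?_))
      · fun_prop
      · simpa using hδ.ne'
    exact this.tendsto.mono_left nhdsWithin_le_nhds
  have hle := le_of_tendsto hlim (Filter.mem_of_superset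
    (Ioo_mem_nhdsGT (zero_lt_one (α := ℝ))) fun η hη' => hη η hη'.1 hη'.2)
  rw [add_zero, ← Real.log_inv, ← one_div] at hle
  exact hle

end Algorithm

/-! ### The tied instance and its cost per query. -/

variable {n : ℕ}

lemma exp_mean_sub_le {a b : ℝ} (h0 : 0 < min a b) (h1 : max a b < 1) (s t : ℝ) :
    Real.exp ((1 - a) * s + a * t -
      (max a b - min a b) ^ 2 / (2 * (min a b * (1 - max a b)))) ≤
      (1 - b) * Real.exp s + b * Real.exp t := by
  rcases le_total a b with h | h
  · simp only [min_eq_left h, max_eq_right h] at *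
    exact exp_mean_sub_le_of_le h0 h h1 s t
  · simp only [min_eq_right h, max_eq_left h] at *
    exact exp_mean_sub_le_of_ge h0 h h1 s t

/-- Changing the mean of an arm that is not queried costs nothing. -/
lemma integral_update_of_insensitive (μ : Fin n → I) (j : Fin n) (q : I) {f : Reward n → ℝ}
    (hf : ∀ x b, f (Function.update x j b) = f x) :
    ∫ x, f x ∂(armLaw (Function.update μ j q)) = ∫ x, f x ∂(armLaw μ) := by
  rw [integral_armLaw_update]
  refine integral_congr_ae (ae_of_all _ fun x => ?_)
  simp only [hf]
  ring

lemma semiBanditFeedback_update {S : Finset (Fin n)} {j : Fin n} (hj : j ∉ S) (x : Reward n)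
    (b : Bool) : semiBanditFeedback S (Function.update x j b) = semiBanditFeedback S x := by
  funext i
  by_cases hi : i ∈ S
  · have : i ≠ j := fun h => hj (h ▸ hi)
    simp [semiBanditFeedback, hi, this]
  · simp [semiBanditFeedback, hi]

lemma banditFeedback_update {S : Finset (Fin n)} {j : Fin n} (hj : j ∉ S) (x : Reward n)
    (b : Bool) : banditFeedback S (Function.update x j b) = banditFeedback S x :=
  Finset.sup_congr rfl fun i hi => by
    have : i ≠ j := fun h => hj (h ▸ hi)
    simp [this]

/-- The cost of a change of the mean of arm `j`, when all the rewards are observed. -/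
lemma exp_integral_sub_le_update (μ : Fin n → I) (j : Fin n) (q : I) {C : ℝ}
    (hC : ∀ s t : ℝ, Real.exp ((1 - (μ j : ℝ)) * s + μ j * t - C) ≤
      (1 - (q : ℝ)) * Real.exp s + q * Real.exp t) (f : Reward n → ℝ) :
    Real.exp (∫ x, f x ∂(armLaw μ) - C) ≤
      ∫ x, Real.exp (f x) ∂(armLaw (Function.update μ j q)) := by
  have hμ := integral_armLaw_update μ j (μ j) f
  rw [Function.update_eq_self] at hμ
  rw [hμ, integral_armLaw_update]
  set g : Reward n → ℝ := fun x => (1 - (μ j : ℝ)) * f (Function.update x j false) +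
    μ j * f (Function.update x j true)
  calc _ = Real.exp (∫ x, (g x - C) ∂(armLaw μ)) := by
        rw [integral_sub (integrable_armLaw _ _) (integrable_const _)]
        simp
    _ ≤ ∫ x, Real.exp (g x - C) ∂(armLaw μ) := exp_integral_armLaw_le _ _
    _ ≤ _ := integral_mono (integrable_armLaw _ _) (integrable_armLaw _ _) fun x => hC _ _

lemma integral_banditFeedback (μ : Fin n → I) (S : Finset (Fin n)) (F : Bool → ℝ) :
    ∫ x, F (banditFeedback S x) ∂(armLaw μ) =
      (∏ i ∈ S, (1 - (μ i : ℝ))) * F false + (1 - ∏ i ∈ S, (1 - (μ i : ℝ))) * F true := by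
  set B : Set (Reward n) := Set.univ.pi fun i => if i ∈ S then {false} else Set.univ with hB
  have hmem : ∀ x, x ∈ B ↔ banditFeedback S x = false := by
    intro x
    rw [banditFeedback, show false = (⊥ : Bool) from rfl, Finset.sup_eq_bot_iff, hB, Set.mem_univ_pi]
    refine forall_congr' fun i => ?_
    by_cases hi : i ∈ S <;> simp [hi]
  have hBm : MeasurableSet B := B.toFinite.measurableSet
  have hreal : (armLaw μ).real B = ∏ i ∈ S, (1 - (μ i : ℝ)) := by
    rw [hB, armLaw, measureReal_def, Measure.pi_pi, ENNReal.toReal_prod,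
      ← Finset.prod_subset (Finset.subset_univ S)]
    · refine Finset.prod_congr rfl fun i hi => ?_
      simp [hi]
    · intro i _ hi
      simp [hi]
  have hF : ∀ x, F (banditFeedback S x) = F true + (F false - F true) * B.indicator 1 x := by
    intro x
    by_cases hx : x ∈ B
    · simp [hx, (hmem x).1 hx]
    · have : banditFeedback S x = true := by
        simpa using fun h => hx ((hmem x).2 h)
      simp [hx, this]
  simp only [hF]
  rw [integral_add (integrable_const _) (integrable_armLaw _ _), integral_const_mul,
    integral_indicator_one hBm, hreal]
  simp
  ring

/-- The mean to which arm `j` is moved in order to create a tie. -/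
def tieMean {k : ℕ} (hkn : k < n) (μ : Fin n → I) (j : Fin n) : I :=
  if (j : ℕ) < k then μ ⟨k, hkn⟩ else μ ⟨k - 1, by omega⟩

variable {k p : ℕ} {μ : Fin n → I}

/-- In terms of the smaller and the larger of the old and new mean of `j`, the two cases in the
definition of `τ` become one formula. -/
lemma min_max_tieMean (hk : 1 ≤ k) (hkn : k < n) (hanti : Antitone μ)
    (hgap : μ ⟨k, hkn⟩ < μ ⟨k - 1, by omega⟩) (j : Fin n) :
    if (j : ℕ) < k then min (μ j : ℝ) (tieMean hkn μ j) = μ j - gap hk hkn μ j ∧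
      max (μ j : ℝ) (tieMean hkn μ j) = μ j
    else min (μ j : ℝ) (tieMean hkn μ j) = μ j ∧
      max (μ j : ℝ) (tieMean hkn μ j) = μ j + gap hk hkn μ j := by
  have hgap' : (μ ⟨k, hkn⟩ : ℝ) < μ ⟨k - 1, by omega⟩ := hgap
  split_ifs with h
  · have h1 : (μ ⟨k, hkn⟩ : ℝ) ≤ μ j := hanti (Fin.mk_le_mk.2 h.le : j ≤ ⟨k, hkn⟩)
    simp [tieMean, gap, h, h1]
  · have h1 : (μ j : ℝ) ≤ μ ⟨k, hkn⟩ := hanti (Fin.mk_le_mk.2 (not_lt.1 h) : ⟨k, hkn⟩ ≤ j)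
    simp [tieMean, gap, h, h1.trans hgap'.le]

lemma tauBandit_eq (hk : 1 ≤ k) (hkn : k < n) (hanti : Antitone μ)
    (hgap : μ ⟨k, hkn⟩ < μ ⟨k - 1, by omega⟩) (j : Fin n) :
    tauBandit p hk hkn μ j =
      (1 - max (μ j : ℝ) (tieMean hkn μ j)) /
        (max (μ j : ℝ) (tieMean hkn μ j) - min (μ j : ℝ) (tieMean hkn μ j)) ^ 2 *
        ((1 - infoSharing p μ j + min (μ j : ℝ) (tieMean hkn μ j) * infoSharing p μ j) /
          infoSharing p μ j) := by
  have h := min_max_tieMean hk hkn hanti hgap j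
  unfold tauBandit
  split_ifs at h ⊢
  · rw [h.1, h.2, sub_sub_cancel]
  · rw [h.1, h.2, add_sub_cancel_left, ← sub_sub]

lemma tauSemiBandit_eq (hk : 1 ≤ k) (hkn : k < n) (hanti : Antitone μ)
    (hgap : μ ⟨k, hkn⟩ < μ ⟨k - 1, by omega⟩)
    (j : Fin n) :
    tauSemiBandit hk hkn μ j =
      (1 - max (μ j : ℝ) (tieMean hkn μ j)) * min (μ j : ℝ) (tieMean hkn μ j) /
        (max (μ j : ℝ) (tieMean hkn μ j) - min (μ j : ℝ) (tieMean hkn μ j)) ^ 2 := by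
  have h := min_max_tieMean hk hkn hanti hgap j
  unfold tauSemiBandit
  split_ifs at h ⊢
  · rw [h.1, h.2, sub_sub_cancel]
  · rw [h.1, h.2, add_sub_cancel_left, ← sub_sub]

lemma tieMean_lt_one (hkn : k < n) (hμ : ∀ i, μ i < 1) (j : Fin n) : tieMean hkn μ j < 1 := by
  unfold tieMean
  split_ifs <;> exact hμ _

lemma exists_top_sets_tieMean (hk : 1 ≤ k) (hkn : k < n) (hanti : Antitone μ)
    (hgap : μ ⟨k, hkn⟩ < μ ⟨k - 1, by omega⟩)
    (j : Fin n) :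
    ∃ S T : Finset (Fin n), S ≠ T ∧
      S.card = k ∧ (∀ i ∈ S, ∀ i' ∉ S, Function.update μ j (tieMean hkn μ j) i' ≤
        Function.update μ j (tieMean hkn μ j) i) ∧
      T.card = k ∧ (∀ i ∈ T, ∀ i' ∉ T, Function.update μ j (tieMean hkn μ j) i' ≤
        Function.update μ j (tieMean hkn μ j) i) := by
  set v := tieMean hkn μ j with hv
  set μ' := Function.update μ j v with hμ'
  have hself : μ' j = v := by simp [hμ']
  have hne : ∀ i, i ≠ j → μ' i = μ i := fun i hi => by simp [hμ', hi]
  have hvk : μ ⟨k, hkn⟩ ≤ v := by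
    rw [hv, tieMean]; split_ifs
    · exact le_rfl
    · exact hgap.le
  have hvk' : v ≤ μ ⟨k - 1, by omega⟩ := by
    rw [hv, tieMean]; split_ifs
    · exact hgap.le
    · exact le_rfl
  have hlow : ∀ i : Fin n, (i : ℕ) < k → v ≤ μ' i := by
    intro i hi
    by_cases hij : i = j
    · rw [hij, hself]
    · rw [hne i hij]
      refine hvk'.trans (hanti (Fin.mk_le_mk.2 (by omega) : i ≤ ⟨k - 1, by omega⟩))
  have hhigh : ∀ i : Fin n, k ≤ (i : ℕ) → μ' i ≤ v := by
    intro i hi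
    by_cases hij : i = j
    · rw [hij, hself]
    · rw [hne i hij]
      exact (hanti (Fin.mk_le_mk.2 hi : ⟨k, hkn⟩ ≤ i)).trans hvk
  -- The tied arms on either side of the boundary: one is `j`, the other the arm whose mean `j`
  -- takes. The second top set swaps them.
  obtain ⟨a, b, ha, hb, hav, hbv⟩ : ∃ a b : Fin n, (a : ℕ) < k ∧ k ≤ (b : ℕ) ∧
      μ' a = v ∧ μ' b = v := by
    by_cases hj : (j : ℕ) < k
    · refine ⟨j, ⟨k, hkn⟩, hj, le_rfl, hself, ?_⟩
      rw [hne _ (fun h => by simp [← h] at hj), hv, tieMean, if_pos hj]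
    · refine ⟨⟨k - 1, by omega⟩, j, by simp; omega, not_lt.1 hj, ?_, hself⟩
      rw [hne _ (fun h => hj (by rw [← h]; simp; omega)), hv, tieMean, if_neg hj]
  set S : Finset (Fin n) := Finset.univ.filter fun i => (i : ℕ) < k with hS
  have hmS : ∀ i, i ∈ S ↔ (i : ℕ) < k := fun i => by simp [hS]
  have haS : a ∈ S := (hmS a).2 ha
  have hbS : b ∉ S := fun h => by have := (hmS b).1 h; omega
  have hbS' : b ∉ S.erase a := fun h => hbS (Finset.mem_of_mem_erase h)
  have hScard : S.card = k := by
    have : S = Finset.Iio (⟨k, hkn⟩ : Fin n) := by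
      ext i
      rw [hmS, Finset.mem_Iio, Fin.lt_def]
    rw [this, Fin.card_Iio]
  refine ⟨S, insert b (S.erase a), fun h => hbS (h ▸ Finset.mem_insert_self _ _), hScard, ?_,
    ?_, ?_⟩
  · intro i hi i' hi'
    exact (hhigh i' (not_lt.1 fun h => hi' ((hmS _).2 h))).trans (hlow i ((hmS _).1 hi))
  · rw [Finset.card_insert_of_notMem hbS', Finset.card_erase_of_mem haS, hScard]
    omega
  · intro i hi i' hi'
    have h1 : v ≤ μ' i := by
      rcases Finset.mem_insert.1 hi with rfl | h
      · exact hbv.ge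
      · exact hlow i ((hmS _).1 (Finset.mem_of_mem_erase h))
    refine le_trans ?_ h1
    by_cases hia : i' = a
    · rw [hia, hav]
    · refine hhigh i' (not_lt.1 fun h => hi' ?_)
      exact Finset.mem_insert_of_mem (Finset.mem_erase.2 ⟨hia, (hmS _).2 h⟩)

lemma infoSharing_nonneg (p : ℕ) (μ : Fin n → I) (j : Fin n) : 0 ≤ infoSharing p μ j :=
  Real.iSup_nonneg fun _ => Finset.prod_nonneg fun i _ => sub_nonneg.2 (μ i).2.2

lemma infoSharing_le_one (p : ℕ) (μ : Fin n → I) (j : Fin n) : infoSharing p μ j ≤ 1 :=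
  Real.iSup_le (fun _ => Finset.prod_le_one (fun i _ => sub_nonneg.2 (μ i).2.2)
    fun i _ => sub_le_self _ (μ i).2.1) zero_le_one

lemma prod_erase_le_infoSharing (μ : Fin n → I) {S : Finset (Fin n)} (hS : S.card = p)
    {j : Fin n} (hj : j ∈ S) : ∏ i ∈ S.erase j, (1 - (μ i : ℝ)) ≤ infoSharing p μ j :=
  le_ciSup (f := fun S : {S : Finset (Fin n) // j ∉ S ∧ S.card = p - 1} =>
      ∏ i ∈ S.1, (1 - (μ i : ℝ))) (Set.finite_range _).bddAbove
    ⟨S.erase j, Finset.notMem_erase _ _, by rw [Finset.card_erase_of_mem hj, hS]⟩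

/-- The cost of a change of the mean of an arm, when the maximum over a set is observed: `g` is the
probability that all the other rewards of the set vanish. -/
lemma exp_mean_sub_le_of_mul {a b g h : ℝ} (h1 : max a b < 1) (hg : 0 < g)
    (hgh : g ≤ h) (hpos : 0 < 1 - h + min a b * h) (hab : min a b < max a b) (s t : ℝ) :
    Real.exp (g * (1 - a) * s + (1 - g * (1 - a)) * t - 1 / (2 * ((1 - max a b) /
      (max a b - min a b) ^ 2 * ((1 - h + min a b * h) / h)))) ≤
      g * (1 - b) * Real.exp s + (1 - g * (1 - b)) * Real.exp t := by
  set lo := min a b with hlo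
  set hi := max a b with hhi
  have hh : 0 < h := hg.trans_le hgh
  have hlo1 : 0 < 1 - lo := by linarith
  have hmin : min (1 - g * (1 - a)) (1 - g * (1 - b)) = 1 - g * (1 - lo) := by
    rcases le_total a b with hle | hle
    · rw [hlo, min_eq_left hle, min_eq_left (by nlinarith)]
    · rw [hlo, min_eq_right hle, min_eq_right (by nlinarith)]
  have hmax : max (1 - g * (1 - a)) (1 - g * (1 - b)) = 1 - g * (1 - hi) := by
    rcases le_total a b with hle | hle
    · rw [hhi, max_eq_right hle, max_eq_right (by nlinarith)]
    · rw [hhi, max_eq_left hle, max_eq_left (by nlinarith)]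
  have hg0 : 0 < 1 - g * (1 - lo) := by nlinarith
  have hhi1 : 0 < 1 - hi := by linarith
  have key := exp_mean_sub_le (a := 1 - g * (1 - a)) (b := 1 - g * (1 - b))
    (by rw [hmin]; exact hg0) (by rw [hmax]; nlinarith [mul_pos hg hhi1]) s t
  rw [hmin, hmax] at key
  refine (Real.exp_le_exp.2 ?_).trans (key.trans_eq (by ring))
  have hd : 0 < hi - lo := by linarith
  have hcost : (1 - g * (1 - hi) - (1 - g * (1 - lo))) ^ 2 /
      (2 * ((1 - g * (1 - lo)) * (1 - (1 - g * (1 - hi))))) ≤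
      1 / (2 * ((1 - hi) / (hi - lo) ^ 2 * ((1 - h + lo * h) / h))) := by
    calc _ = (hi - lo) ^ 2 / (2 * (1 - hi)) * (g / (1 - g * (1 - lo))) := by
          have : 1 - (1 - g * (1 - hi)) = g * (1 - hi) := by ring
          rw [this]
          field_simp
          ring
      -- `g / (1 - g * (1 - lo))` increases with `g`, so the largest product `h` is the worst case.
      _ ≤ (hi - lo) ^ 2 / (2 * (1 - hi)) * (h / (1 - h + lo * h)) := by
          gcongr ?_ * ?_
          rw [div_le_div_iff₀ hg0 hpos]
          nlinarith
      _ = _ := by field_simp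
  linarith

end BestOfK

end

theorem theorem6 {n k p : ℕ} (hp : 1 ≤ p) (hpk : p ≤ k) (hk : 1 ≤ k) (hkn : k < n)
    {δ : ℝ} (hδ0 : 0 < δ) (hδ1 : δ < 1)
    (μ : Fin n → unitInterval) (hμ : ∀ i, μ i < 1) (hanti : Antitone μ)
    (hgap : μ ⟨k, hkn⟩ < μ ⟨k - 1, by omega⟩)
    {U : Type*} [MeasurableSpace U] (ρ : MeasureTheory.Measure U)
    [MeasureTheory.IsProbabilityMeasure ρ] :
    (∀ A : BestOfK.Algorithm n p Bool U,
      A.IdentifiesTop BestOfK.banditFeedback ρ k δ →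
        ENNReal.ofReal (BestOfK.lowerBound p δ (BestOfK.tauBandit p hk hkn μ)) ≤
          A.expectedQueries BestOfK.banditFeedback ρ μ) ∧
    (∀ A : BestOfK.Algorithm n p (Fin n → Option Bool) U,
      A.IdentifiesTop BestOfK.semiBanditFeedback ρ k δ →
        ENNReal.ofReal (BestOfK.lowerBound p δ (BestOfK.tauSemiBandit hk hkn μ)) ≤
          A.expectedQueries BestOfK.semiBanditFeedback ρ μ) := by
  open BestOfK in
  have hupd : ∀ j i, Function.update μ j (tieMean hkn μ j) i < 1 := by
    intro j i
    by_cases hi : i = j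
    · rw [hi, Function.update_self]; exact tieMean_lt_one hkn hμ j
    · rw [Function.update_of_ne hi]; exact hμ i
  have hmin0 : ∀ j, 0 ≤ min (μ j : ℝ) (tieMean hkn μ j) := fun j =>
    le_min (μ j).2.1 (tieMean hkn μ j).2.1
  have hmax1 : ∀ j, max (μ j : ℝ) (tieMean hkn μ j) < 1 := fun j =>
    max_lt (hμ j) (tieMean_lt_one hkn hμ j)
  refine ⟨fun A hA => ?_, fun A hA => ?_⟩
  · refine hA.lowerBound_le hδ0 hp (by omega) (fun j => ?_) fun j hj =>
      ⟨Function.update μ j (tieMean hkn μ j), hupd j,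
        exists_top_sets_tieMean hk hkn hanti hgap j, fun S hS F => ?_⟩
    · rw [tauBandit_eq hk hkn hanti hgap]
      have h0 := infoSharing_nonneg p μ j
      have h1 := infoSharing_le_one p μ j
      have := mul_nonneg (hmin0 j) h0
      exact mul_nonneg (div_nonneg (by linarith [hmax1 j]) (sq_nonneg _))
        (div_nonneg (by linarith) h0)
    · by_cases hjS : j ∈ S
      · rw [tauBandit_eq hk hkn hanti hgap] at hj
        have hg : 0 < ∏ i ∈ S.erase j, (1 - (μ i : ℝ)) :=
          Finset.prod_pos fun i _ => sub_pos.2 (hμ i)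
        have hgh := prod_erase_le_infoSharing μ hS hjS
        have hlt : min (μ j : ℝ) (tieMean hkn μ j) < max (μ j : ℝ) (tieMean hkn μ j) := by
          -- With equal means the division by zero would make `τ` zero, against `hj`.
          refine lt_of_le_of_ne min_le_max fun h => ?_
          simp [h] at hj
        have hfac := pos_of_mul_pos_right hj
          (div_nonneg (by linarith [hmax1 j]) (sq_nonneg _))
        -- This excludes `h = 1` with smaller mean `0`, where `τ` vanishes and the observed maximum
        -- would have mean `0` under one of the instances.
        have hpos := (div_pos_iff_of_pos_right (hg.trans_le hgh)).1 hfac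
        have key := exp_mean_sub_le_of_mul (hmax1 j) hg hgh hpos hlt (F false) (F true)
        rw [if_pos hjS, tauBandit_eq hk hkn hanti hgap, integral_banditFeedback μ S F,
          integral_banditFeedback _ S fun o => Real.exp (F o),
          ← Finset.mul_prod_erase S _ hjS, ← Finset.mul_prod_erase S _ hjS]
        have herase : ∏ i ∈ S.erase j,
            (1 - (Function.update μ j (tieMean hkn μ j) i : ℝ)) =
            ∏ i ∈ S.erase j, (1 - (μ i : ℝ)) :=
          Finset.prod_congr rfl fun i hi => by
            rw [Function.update_of_ne (Finset.ne_of_mem_erase hi)]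
        rw [herase, Function.update_self]
        simpa only [mul_comm (∏ i ∈ S.erase j, (1 - (μ i : ℝ)))] using key
      · rw [if_neg hjS, sub_zero, integral_update_of_insensitive μ j _ fun x b => by
          rw [banditFeedback_update hjS]]
        exact exp_integral_armLaw_le _ _
  · refine hA.lowerBound_le hδ0 hp (by omega) (fun j => ?_) fun j hj =>
      ⟨Function.update μ j (tieMean hkn μ j), hupd j,
        exists_top_sets_tieMean hk hkn hanti hgap j, fun S hS F => ?_⟩
    · rw [tauSemiBandit_eq hk hkn hanti hgap]
      exact div_nonneg (mul_nonneg (by linarith [hmax1 j]) (hmin0 j)) (sq_nonneg _)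
    · by_cases hjS : j ∈ S
      · rw [tauSemiBandit_eq hk hkn hanti hgap] at hj ⊢
        have hmin : 0 < min (μ j : ℝ) (tieMean hkn μ j) := by
          refine lt_of_le_of_ne (hmin0 j) fun h => ?_
          simp [← h] at hj
        rw [if_pos hjS]
        refine exp_integral_sub_le_update μ j _ (fun s t => ?_) fun x => F (semiBanditFeedback S x)
        convert exp_mean_sub_le hmin (hmax1 j) s t using 3
        rw [← mul_div_assoc, one_div_div, mul_comm (1 - _)]
      · rw [if_neg hjS, sub_zero, integral_update_of_insensitive μ j _ fun x b => by
          rw [semiBanditFeedback_update hjS]]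
        exact exp_integral_armLaw_le _ _
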